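/- Let $\mathbb{S}^n$ be the space of real symmetric $n\times n$ matrices with the inner product $\langle A,B\rangle=\operatorname{tr}(A^{T}B)$ and the induced Frobenius norm, and for $X\in\mathbb{S}^n$ let $\lambda(X)\in\mathbb{R}^n$ be the vector of eigenvalues of $X$ (with multiplicities), arranged in non-increasing order $\lambda_1(X)\ge\dots\ge\lambda_n(X)$. A function $p$ from a Euclidean space $\mathbb{U}$ to $(-\infty,+\infty]$ has the subdifferential $\partial p(x)=\{v\in\mathbb{U} : p(y)\ge p(x)+\langle v,y-x\rangle \text{ for all } y\in\mathbb{U}\}$. A set-valued mapping $G:\mathbb{U}\rightrightarrows\mathbb{V}$ between finite dimensional Euclidean spaces is called metrically subregular at $\bar u$ for $\bar v$ if $\bar v\in G(\bar u)$ and there exist constants $\delta>0$, $\varepsilon>0$ and $\kappa>0$ such that $$\operatorname{dist}\bigl(u,G^{-1}(\bar v)\bigr)\le\kappa\,\operatorname{dist}\bigl(\bar v,\,G(u)\cap\mathbb{B}_\delta(\bar v)\bigr)\qquad\text{for all } u\in\mathbb{B}_\varepsilon(\bar u),$$ where $\mathbb{B}_\rho(\cdot)$ denotes the closed ball of radius $\rho$,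 $G^{-1}(\bar v)=\{u : \bar v\in G(u)\}$, and $\operatorname{dist}(\cdot,\emptyset)=+\infty$. Let $g:\mathbb{R}^n\to(-\infty,+\infty]$ be a proper closed convex function that is symmetric, i.e. $g(x)=g(Qx)$ for every $x\in\mathbb{R}^n$ and every $n\times n$ permutation matrix $Q$. Let $\theta:\mathbb{S}^n\to(-\infty,+\infty]$ be the spectral function $\theta(X)=g(\lambda(X))$, and let $\overline{X},\overline{W}\in\mathbb{S}^n$ satisfy $\overline{W}\in\partial\theta(\overline{X})$. If the subdifferential mapping $\partial g$ is metrically subregular at $\lambda(\overline{X})$ for $\lambda(\overline{W})$, then the subdifferential mapping $\partial\theta$ is metrically subregular at $\overline{X}$ for $\overline{W}$. -/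

import Mathlib

open scoped RealInnerProductSpace

-- Matrices carry the Frobenius norm throughout.
attribute [local instance] Matrix.frobeniusNormedAddCommGroup Matrix.frobeniusNormedSpace

namespace SpectralSubregularity

/-! ### Convex analysis on real inner product spaces -/

section ConvexAnalysis

variable {U V : Type*} [NormedAddCommGroup U] [InnerProductSpace ℝ U]
  [NormedAddCommGroup V] [InnerProductSpace ℝ V]

/-- An extended-real-valued function that is proper (nowhere `-∞` and not identically `+∞`),
closed (lower semicontinuous) and convex (its epigraph is a convex set). -/
structure IsProperClosedConvex (p : U → EReal) : Prop where
  ne_bot : ∀ x, p x ≠ ⊥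
  exists_ne_top : ∃ x, p x ≠ ⊤
  lowerSemicontinuous : LowerSemicontinuous p
  convex_epigraph : Convex ℝ {q : U × ℝ | p q.1 ≤ (q.2 : EReal)}

/-- The subdifferential of convex analysis:
`v ∈ ∂p(x)` iff `p y ≥ p x + ⟪v, y - x⟫` for all `y`. -/
def subdifferential (p : U → EReal) (x : U) : Set U :=
  {v | ∀ y, p x + ((⟪v, y - x⟫ : ℝ) : EReal) ≤ p y}

/-- Metric subregularity of the set-valued mapping `G` at `u₀` for `v₀`. The distances are
extended-real-valued, so that the distance to the empty set is `∞`. -/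
def MetricallySubregularAt (G : U → Set V) (u₀ : U) (v₀ : V) : Prop :=
  v₀ ∈ G u₀ ∧ ∃ δ > (0 : ℝ), ∃ ε > (0 : ℝ), ∃ κ > (0 : ℝ), ∀ u ∈ Metric.closedBall u₀ ε,
    Metric.infEDist u {u' | v₀ ∈ G u'} ≤
      ENNReal.ofReal κ * Metric.infEDist v₀ (G u ∩ Metric.closedBall v₀ δ)

end ConvexAnalysis

/-! ### The Euclidean space of real symmetric matrices -/

/-- The inner product `⟪A, B⟫ = tr(Aᵀ B)` on real square matrices; its norm is the
Frobenius norm. -/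
noncomputable instance frobeniusInnerProductSpace (n : ℕ) :
    InnerProductSpace ℝ (Matrix (Fin n) (Fin n) ℝ) where
  inner A B := (A.transpose * B).trace
  norm_sq_eq_re_inner A := by
    rw [Matrix.frobenius_norm_def, ← Real.rpow_natCast, ← Real.rpow_mul (by positivity)]
    simp only [Nat.cast_ofNat, Matrix.trace, Matrix.diag, Matrix.mul_apply,
      Matrix.transpose_apply]
    rw [Finset.sum_comm]
    simp [pow_two]
  conj_inner_symm A B := by
    rw [← Matrix.trace_transpose (B.transpose * A)]
    simp [Matrix.transpose_mul]
  add_left A B C := by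
    simp [Matrix.transpose_add, Matrix.add_mul, Matrix.trace_add]
  smul_left A B r := by
    simp [Matrix.transpose_smul, Matrix.trace_smul]

/-- The linear subspace of symmetric `n × n` real matrices. -/
def symmetricMatrices (n : ℕ) : Submodule ℝ (Matrix (Fin n) (Fin n) ℝ) where
  carrier := {X | X.IsSymm}
  add_mem' hX hY := Matrix.IsSymm.add hX hY
  zero_mem' := Matrix.isSymm_zero
  smul_mem' r _ hX := Matrix.IsSymm.smul hX r

/-- `𝕊ⁿ`, a Euclidean space with the inner product `tr(Aᵀ B)`. -/
abbrev SymMat (n : ℕ) : Type := ↥(symmetricMatrices n)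

theorem SymMat.isHermitian {n : ℕ} (X : SymMat n) :
    (X : Matrix (Fin n) (Fin n) ℝ).IsHermitian := by
  have h : (X : Matrix (Fin n) (Fin n) ℝ).transpose = X := X.2
  rw [Matrix.IsHermitian, Matrix.conjTranspose_eq_transpose_of_trivial, h]

/-- `λ(X)`: the vector of eigenvalues of `X` with multiplicities, in non-increasing order
(Mathlib's `eigenvalues₀` is the antitone enumeration). -/
noncomputable def eigenvalueVector {n : ℕ} (X : SymMat n) : EuclideanSpace ℝ (Fin n) :=
  WithLp.toLp 2 fun i => X.isHermitian.eigenvalues₀ (Fin.cast (Fintype.card_fin n).symm i)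

/-- A function on `ℝⁿ` is symmetric if it is invariant under permutations of coordinates. -/
def IsSymmetricFun {n : ℕ} (g : EuclideanSpace ℝ (Fin n) → EReal) : Prop :=
  ∀ (x : EuclideanSpace ℝ (Fin n)) (σ : Equiv.Perm (Fin n)),
    g x = g (WithLp.toLp 2 fun i => x (σ i))

/-- The spectral function `θ = g ∘ λ` on `𝕊ⁿ`. -/
noncomputable def spectralFunction {n : ℕ} (g : EuclideanSpace ℝ (Fin n) → EReal)
    (X : SymMat n) : EReal :=
  g (eigenvalueVector X)

end SpectralSubregularity

open SpectralSubregularity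

namespace SpectralSubregularity

open Matrix

variable {n : ℕ}

/-! ### The Frobenius norm and orthogonal matrices -/

/-! Let `X` be near `X₀` and let `W ∈ ∂θ(X)` be near `W₀`. Testing the subgradient inequality on
matrices that share an eigenbasis with `W` gives `λ(W) ∈ ∂g(λ(X))` and equality in Fan's inequality
`⟪X, W⟫ ≤ ⟪λ(X), λ(W)⟫`. Hence `X` and `W` have a common ordered eigenbasis `U`
(`exists_simultaneous_conjDiagonal`).

Eigenbases do not vary continuously, but `U` lies within `O(‖W - W₀‖)` of some ordered eigenbasis
`V` of `W₀` (`exists_eigenbasis_near`). As `X` stays bounded, replacing it by `V Diag(λ(X)) Vᵀ`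
costs `O(‖W - W₀‖)`. The isometry `y ↦ V Diag(y) Vᵀ` carries solutions of `λ(W₀) ∈ ∂g(y)` to
solutions of `W₀ ∈ ∂θ(Y)`, so subregularity of `∂g` bounds the remaining distance, `λ` being
1-Lipschitz. -/

theorem frobenius_norm_sq (A : Matrix (Fin n) (Fin n) ℝ) : ‖A‖ ^ 2 = (Aᵀ * A).trace :=
  (real_inner_self_eq_norm_sq A).symm

theorem frobenius_norm_sq_eq_sum (A : Matrix (Fin n) (Fin n) ℝ) :
    ‖A‖ ^ 2 = ∑ i, ∑ j, A i j ^ 2 := by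
  rw [frobenius_norm_sq, Finset.sum_comm]
  simp [Matrix.trace, Matrix.mul_apply, pow_two]

theorem frobenius_norm_le_mul_of_abs_le {A B : Matrix (Fin n) (Fin n) ℝ} {c : ℝ} (hc : 0 ≤ c)
    (h : ∀ i j, c * |A i j| ≤ |B i j|) : c * ‖A‖ ≤ ‖B‖ := by
  refine (sq_le_sq₀ (by positivity) (norm_nonneg _)).1 ?_
  rw [mul_pow, frobenius_norm_sq_eq_sum, frobenius_norm_sq_eq_sum, Finset.mul_sum]
  refine Finset.sum_le_sum fun i _ => ?_
  rw [Finset.mul_sum]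
  refine Finset.sum_le_sum fun j _ => ?_
  rw [← sq_abs (A i j), ← sq_abs (B i j), ← mul_pow]
  exact pow_le_pow_left₀ (by positivity) (h i j) 2

theorem transpose_mul_self_of_orthogonal {U : Matrix (Fin n) (Fin n) ℝ}
    (hU : U ∈ orthogonalGroup (Fin n) ℝ) : Uᵀ * U = 1 :=
  (mem_orthogonalGroup_iff' _ _).1 hU

theorem mul_transpose_self_of_orthogonal {U : Matrix (Fin n) (Fin n) ℝ}
    (hU : U ∈ orthogonalGroup (Fin n) ℝ) : U * Uᵀ = 1 :=
  (mem_orthogonalGroup_iff _ _).1 hU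

theorem transpose_mem_orthogonalGroup {U : Matrix (Fin n) (Fin n) ℝ}
    (hU : U ∈ orthogonalGroup (Fin n) ℝ) : Uᵀ ∈ orthogonalGroup (Fin n) ℝ := by
  rw [mem_orthogonalGroup_iff, transpose_transpose]
  exact transpose_mul_self_of_orthogonal hU

theorem frobenius_norm_orthogonal_mul {U : Matrix (Fin n) (Fin n) ℝ}
    (hU : U ∈ orthogonalGroup (Fin n) ℝ) (A : Matrix (Fin n) (Fin n) ℝ) : ‖U * A‖ = ‖A‖ := by
  rw [← sq_eq_sq₀ (norm_nonneg _) (norm_nonneg _), frobenius_norm_sq, frobenius_norm_sq,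
    transpose_mul, Matrix.mul_assoc, ← Matrix.mul_assoc Uᵀ, transpose_mul_self_of_orthogonal hU,
    Matrix.one_mul]

theorem frobenius_norm_mul_orthogonal {U : Matrix (Fin n) (Fin n) ℝ}
    (hU : U ∈ orthogonalGroup (Fin n) ℝ) (A : Matrix (Fin n) (Fin n) ℝ) : ‖A * U‖ = ‖A‖ := by
  rw [← frobenius_norm_transpose, transpose_mul,
    frobenius_norm_orthogonal_mul (transpose_mem_orthogonalGroup hU), frobenius_norm_transpose]

/-! ### Symmetric matrices with a prescribed eigenbasis -/

/-- The symmetric matrix `U Diag(x) Uᵀ`. -/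
def conjDiagonal (U : Matrix (Fin n) (Fin n) ℝ) (x : EuclideanSpace ℝ (Fin n)) : SymMat n :=
  ⟨U * diagonal x * Uᵀ, by
    change (U * diagonal x * Uᵀ)ᵀ = _
    simp [Matrix.mul_assoc]⟩

theorem coe_conjDiagonal (U : Matrix (Fin n) (Fin n) ℝ) (x : EuclideanSpace ℝ (Fin n)) :
    (conjDiagonal U x : Matrix (Fin n) (Fin n) ℝ) = U * diagonal x * Uᵀ := rfl

theorem conjDiagonal_sub (U : Matrix (Fin n) (Fin n) ℝ) (x y : EuclideanSpace ℝ (Fin n)) :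
    conjDiagonal U x - conjDiagonal U y = conjDiagonal U (x - y) := by
  apply Subtype.ext
  simp only [AddSubgroupClass.coe_sub, coe_conjDiagonal, ← Matrix.sub_mul, ← Matrix.mul_sub,
    diagonal_sub]
  rfl

theorem inner_symMat (X Y : SymMat n) :
    ⟪X, Y⟫ = ((X : Matrix (Fin n) (Fin n) ℝ) * (Y : Matrix (Fin n) (Fin n) ℝ)).trace := by
  have h : (X : Matrix (Fin n) (Fin n) ℝ)ᵀ = X := X.2
  change ((X : Matrix (Fin n) (Fin n) ℝ)ᵀ * (Y : Matrix (Fin n) (Fin n) ℝ)).trace = _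
  rw [h]

theorem norm_conjDiagonal {U : Matrix (Fin n) (Fin n) ℝ} (hU : U ∈ orthogonalGroup (Fin n) ℝ)
    (x : EuclideanSpace ℝ (Fin n)) : ‖conjDiagonal U x‖ = ‖x‖ := by
  change ‖U * diagonal x * Uᵀ‖ = ‖x‖
  rw [frobenius_norm_mul_orthogonal (transpose_mem_orthogonalGroup hU),
    frobenius_norm_orthogonal_mul hU]
  exact frobenius_norm_diagonal _

theorem dist_conjDiagonal {U : Matrix (Fin n) (Fin n) ℝ} (hU : U ∈ orthogonalGroup (Fin n) ℝ)
    (x y : EuclideanSpace ℝ (Fin n)) : dist (conjDiagonal U x) (conjDiagonal U y) = dist x y := by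
  rw [dist_eq_norm, dist_eq_norm, conjDiagonal_sub, norm_conjDiagonal hU]

theorem inner_conjDiagonal {U : Matrix (Fin n) (Fin n) ℝ} (hU : U ∈ orthogonalGroup (Fin n) ℝ)
    (x y : EuclideanSpace ℝ (Fin n)) : ⟪conjDiagonal U x, conjDiagonal U y⟫ = ⟪x, y⟫ := by
  rw [real_inner_eq_norm_mul_self_add_norm_mul_self_sub_norm_sub_mul_self_div_two,
    conjDiagonal_sub, norm_conjDiagonal hU, norm_conjDiagonal hU, norm_conjDiagonal hU,
    ← real_inner_eq_norm_mul_self_add_norm_mul_self_sub_norm_sub_mul_self_div_two]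

/-- The inner product of two diagonalized matrices in terms of the entries of `Uᵀ V`. -/
theorem inner_conjDiagonal_conjDiagonal (U V : Matrix (Fin n) (Fin n) ℝ)
    (x y : EuclideanSpace ℝ (Fin n)) :
    ⟪conjDiagonal U x, conjDiagonal V y⟫ = ∑ i, ∑ j, x i * y j * (Uᵀ * V) i j ^ 2 := by
  have h : ((conjDiagonal U x : Matrix (Fin n) (Fin n) ℝ) * conjDiagonal V y).trace =
      (diagonal x * (Uᵀ * V) * (diagonal y * (Uᵀ * V)ᵀ)).trace := by
    rw [coe_conjDiagonal, coe_conjDiagonal, Matrix.mul_assoc, Matrix.mul_assoc, trace_mul_comm]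
    simp only [transpose_mul, transpose_transpose, Matrix.mul_assoc]
  rw [inner_symMat, h]
  simp only [Matrix.trace, Matrix.diag, Matrix.mul_apply (M := diagonal _ * _), diagonal_mul,
    transpose_apply]
  refine Finset.sum_congr rfl fun i _ => Finset.sum_congr rfl fun j _ => ?_
  ring

theorem antitone_eigenvalueVector (X : SymMat n) : Antitone (eigenvalueVector X) :=
  fun _ _ h => X.isHermitian.eigenvalues₀_antitone h

/-- The spectral theorem, with the eigenvalues in non-increasing order. -/
theorem exists_eq_conjDiagonal (X : SymMat n) :
    ∃ U ∈ orthogonalGroup (Fin n) ℝ, X = conjDiagonal U (eigenvalueVector X) := by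
  -- `eigenvalues` lists `eigenvalues₀` through an arbitrary equivalence; `e` restores the
  -- non-increasing order.
  let e : Fin n ≃ Fin n := (finCongr (Fintype.card_fin n).symm).trans
    (Fintype.equivOfCardEq (Fintype.card_fin _))
  have he : ∀ i, X.isHermitian.eigenvalues (e i) = eigenvalueVector X i := fun i => by
    simp [e, IsHermitian.eigenvalues, eigenvalueVector]
  have hU := X.isHermitian.eigenvectorUnitary.2
  set U : Matrix (Fin n) (Fin n) ℝ := X.isHermitian.eigenvectorUnitary.1
  have hX : (X : Matrix (Fin n) (Fin n) ℝ) = U * diagonal X.isHermitian.eigenvalues * Uᵀ := by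
    have := X.isHermitian.spectral_theorem
    rw [Unitary.conjStarAlgAut_apply] at this
    exact this
  refine ⟨U.submatrix id e, ?_, Subtype.ext ?_⟩
  · rw [mem_orthogonalGroup_iff, transpose_submatrix, submatrix_mul_equiv]
    simpa using mul_transpose_self_of_orthogonal hU
  · have hd : diagonal (eigenvalueVector X) =
        (diagonal X.isHermitian.eigenvalues).submatrix e e := by
      rw [submatrix_diagonal_equiv]
      congr 1
      exact funext fun i => (he i).symm
    rw [coe_conjDiagonal, hd, transpose_submatrix, submatrix_mul_equiv, submatrix_mul_equiv, ← hX,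
      submatrix_id_id]

/-- Equal multisets of values have equinumerous fibres, and bijections between fibres glue to a
permutation. -/
theorem exists_perm_of_map_univ_eq {α β : Type*} [Fintype α] [DecidableEq β] {f g : α → β}
    (h : Finset.univ.val.map f = Finset.univ.val.map g) : ∃ σ : Equiv.Perm α, f = g ∘ σ := by
  have hcard : ∀ c, Nonempty ({a // f a = c} ≃ {a // g a = c}) := fun c => by
    have := congrArg (Multiset.count c) h
    rw [Multiset.count_map, Multiset.count_map] at this
    rw [← Fintype.card_eq, Fintype.card_subtype, Fintype.card_subtype]
    simpa [Finset.card, eq_comm] using this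
  let e := fun c => (hcard c).some
  exact ⟨Equiv.ofFiberEquiv e, funext fun a => (Equiv.ofFiberEquiv_map e a).symm⟩

theorem exists_perm_eigenvalueVector_conjDiagonal {U : Matrix (Fin n) (Fin n) ℝ}
    (hU : U ∈ orthogonalGroup (Fin n) ℝ) (x : EuclideanSpace ℝ (Fin n)) :
    ∃ σ : Equiv.Perm (Fin n),
      eigenvalueVector (conjDiagonal U x) = WithLp.toLp 2 fun i => x (σ i) := by
  obtain ⟨V, hV, hX⟩ := exists_eq_conjDiagonal (conjDiagonal U x)
  set y := eigenvalueVector (conjDiagonal U x)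
  -- The characteristic polynomial recovers the diagonal as a multiset, whatever the eigenbasis.
  have key : ∀ {W : Matrix (Fin n) (Fin n) ℝ}, W ∈ orthogonalGroup (Fin n) ℝ →
      ∀ z : EuclideanSpace ℝ (Fin n), (conjDiagonal W z).1.charpoly.roots =
        Finset.univ.val.map (z : Fin n → ℝ) := fun {W} hW z => by
    rw [coe_conjDiagonal, charpoly_mul_comm, ← Matrix.mul_assoc, transpose_mul_self_of_orthogonal hW,
      Matrix.one_mul, charpoly_diagonal]
    rw [← Polynomial.roots_multiset_prod_X_sub_C (Finset.univ.val.map (z : Fin n → ℝ)),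
      Multiset.map_map]
    rfl
  obtain ⟨σ, hσ⟩ := exists_perm_of_map_univ_eq (f := (y : Fin n → ℝ)) (g := (x : Fin n → ℝ)) <| by
    rw [← key hU x, ← key hV y, ← hX]
  exact ⟨σ, by ext i; exact congrFun hσ i⟩

theorem spectralFunction_conjDiagonal {g : EuclideanSpace ℝ (Fin n) → EReal}
    (hg : IsSymmetricFun g) {U : Matrix (Fin n) (Fin n) ℝ} (hU : U ∈ orthogonalGroup (Fin n) ℝ)
    (x : EuclideanSpace ℝ (Fin n)) : spectralFunction g (conjDiagonal U x) = g x := by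
  obtain ⟨σ, hσ⟩ := exists_perm_eigenvalueVector_conjDiagonal hU x
  rw [spectralFunction, hσ, ← hg]

theorem norm_eigenvalueVector (X : SymMat n) : ‖eigenvalueVector X‖ = ‖X‖ := by
  obtain ⟨U, hU, hX⟩ := exists_eq_conjDiagonal X
  conv_rhs => rw [hX, norm_conjDiagonal hU]

/-! ### Fan's trace inequality -/

/-- The left side is linear in `M`, so by Birkhoff's theorem only permutation matrices matter; there
it is the rearrangement inequality. -/
theorem sum_mul_mul_le_of_mem_doublyStochastic {ι : Type*} [Fintype ι] [DecidableEq ι]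
    {a b : ι → ℝ} (hab : Monovary a b) {M : Matrix ι ι ℝ} (hM : M ∈ doublyStochastic ℝ ι) :
    ∑ i, ∑ j, a i * b j * M i j ≤ ∑ i, a i * b i := by
  let f : Matrix ι ι ℝ →ₗ[ℝ] ℝ := ∑ i, ∑ j, (a i * b j) • Matrix.entryLinearMap ℝ ℝ i j
  have hf : ∀ N, f N = ∑ i, ∑ j, a i * b j * N i j := fun N => by
    simp [f, LinearMap.sum_apply]
  rw [← SetLike.mem_coe, doublyStochastic_eq_convexHull_permMatrix] at hM
  have := convexHull_min (t := {N | f N ≤ ∑ i, a i * b i}) ?_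
    (convex_halfSpace_le f.isLinear _) hM
  · simpa [hf] using this
  · rintro _ ⟨σ, rfl⟩
    simp only [Set.mem_ofPred_eq, hf, Equiv.Perm.permMatrix, PEquiv.toMatrix_apply]
    simpa [eq_comm] using hab.sum_mul_comp_perm_le_sum_mul (σ := σ)

theorem sq_mem_doublyStochastic {U : Matrix (Fin n) (Fin n) ℝ}
    (hU : U ∈ orthogonalGroup (Fin n) ℝ) :
    (Matrix.of fun i j => U i j ^ 2) ∈ doublyStochastic ℝ (Fin n) := by
  rw [mem_doublyStochastic_iff_sum]
  refine ⟨fun i j => sq_nonneg _, fun i => ?_, fun j => ?_⟩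
  · simpa [Matrix.mul_apply, pow_two] using congrFun₂ (mul_transpose_self_of_orthogonal hU) i i
  · simpa [Matrix.mul_apply, pow_two] using congrFun₂ (transpose_mul_self_of_orthogonal hU) j j

theorem inner_conjDiagonal_le {U V : Matrix (Fin n) (Fin n) ℝ}
    (hU : U ∈ orthogonalGroup (Fin n) ℝ) (hV : V ∈ orthogonalGroup (Fin n) ℝ)
    {x y : EuclideanSpace ℝ (Fin n)} (hx : Antitone x) (hy : Antitone y) :
    ⟪conjDiagonal U x, conjDiagonal V y⟫ ≤ ⟪x, y⟫ := by
  rw [inner_conjDiagonal_conjDiagonal]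
  refine (sum_mul_mul_le_of_mem_doublyStochastic (hx.monovary hy)
    (sq_mem_doublyStochastic (mul_mem (transpose_mem_orthogonalGroup hU) hV))).trans_eq ?_
  simp [PiLp.inner_apply, mul_comm]

theorem inner_le_inner_eigenvalueVector (X Y : SymMat n) :
    ⟪X, Y⟫ ≤ ⟪eigenvalueVector X, eigenvalueVector Y⟫ := by
  obtain ⟨U, hU, hX⟩ := exists_eq_conjDiagonal X
  obtain ⟨V, hV, hY⟩ := exists_eq_conjDiagonal Y
  conv_lhs => rw [hX, hY]
  exact inner_conjDiagonal_le hU hV (antitone_eigenvalueVector X) (antitone_eigenvalueVector Y)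

theorem norm_eigenvalueVector_sub_le (X Y : SymMat n) :
    ‖eigenvalueVector X - eigenvalueVector Y‖ ≤ ‖X - Y‖ := by
  refine (sq_le_sq₀ (by positivity) (norm_nonneg _)).1 ?_
  rw [norm_sub_sq_real, norm_sub_sq_real, norm_eigenvalueVector, norm_eigenvalueVector]
  linarith [inner_le_inner_eigenvalueVector X Y]

/-- Equality in Fan's trace inequality forces a simultaneous ordered diagonalization. -/
theorem exists_simultaneous_conjDiagonal {X Y : SymMat n}
    (h : ⟪eigenvalueVector X, eigenvalueVector Y⟫ ≤ ⟪X, Y⟫) :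
    ∃ U ∈ orthogonalGroup (Fin n) ℝ, X = conjDiagonal U (eigenvalueVector X) ∧
      Y = conjDiagonal U (eigenvalueVector Y) := by
  -- An ordered eigenbasis of the sum turns out to diagonalize both summands.
  obtain ⟨U, hU, hXY⟩ := exists_eq_conjDiagonal (X + Y)
  have hfan : ∀ (Z : SymMat n) {z : EuclideanSpace ℝ (Fin n)}, Antitone z →
      ⟪conjDiagonal U z, Z⟫ ≤ ⟪z, eigenvalueVector Z⟫ := fun Z z hz => by
    obtain ⟨V, hV, hZ⟩ := exists_eq_conjDiagonal Z
    conv_lhs => rw [hZ]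
    exact inner_conjDiagonal_le hU hV hz (antitone_eigenvalueVector Z)
  have hnorm : ‖eigenvalueVector X + eigenvalueVector Y‖ ^ 2 ≤ ‖X + Y‖ ^ 2 := by
    rw [norm_add_sq_real, norm_add_sq_real, norm_eigenvalueVector, norm_eigenvalueVector]
    linarith
  -- Fan's inequality gives `‖X + Y‖² ≤ ⟪λ(X) + λ(Y), λ(X + Y)⟫`, and neither vector on the right is
  -- longer than `‖X + Y‖`, so they coincide.
  have hsum : eigenvalueVector (X + Y) = eigenvalueVector X + eigenvalueVector Y := by
    have h1 := inner_le_inner_eigenvalueVector X (X + Y)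
    have h2 := inner_le_inner_eigenvalueVector Y (X + Y)
    have h3 : ⟪X, X + Y⟫ + ⟪Y, X + Y⟫ = ‖X + Y‖ ^ 2 := by
      rw [← inner_add_left, real_inner_self_eq_norm_sq]
    rw [← sub_eq_zero, ← norm_eq_zero, ← sq_eq_zero_iff]
    refine le_antisymm ?_ (sq_nonneg _)
    rw [norm_sub_sq_real, norm_eigenvalueVector, inner_add_right, real_inner_comm,
      real_inner_comm (eigenvalueVector Y)]
    linarith
  -- Pairing `U Diag(λ(A)) Uᵀ` with `A + B` gives `‖λ(A)‖² + ⟪λ(A), λ(B)⟫`. Fan caps the share of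
  -- `B` at the second term, so the share of `A` is at least `‖A‖²`, which forces equality with `A`.
  have hdiag : ∀ (A B : SymMat n), A + B = X + Y →
      eigenvalueVector A + eigenvalueVector B = eigenvalueVector X + eigenvalueVector Y →
      A = conjDiagonal U (eigenvalueVector A) := fun A B hAB hlam => by
    have hz := antitone_eigenvalueVector A
    have h1 := hfan B hz
    have h2 : ⟪conjDiagonal U (eigenvalueVector A), A + B⟫ =
        ⟪eigenvalueVector A, eigenvalueVector A + eigenvalueVector B⟫ := by
      rw [hAB, hlam, ← hsum]
      conv_lhs => rw [hXY, inner_conjDiagonal hU]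
    rw [inner_add_right, inner_add_right, real_inner_self_eq_norm_sq] at h2
    rw [← sub_eq_zero, ← norm_eq_zero, ← sq_eq_zero_iff]
    refine le_antisymm ?_ (sq_nonneg _)
    rw [norm_sub_sq_real, norm_conjDiagonal hU, real_inner_comm]
    rw [norm_eigenvalueVector] at h2 ⊢
    linarith
  exact ⟨U, hU, hdiag X Y rfl rfl, hdiag Y X (add_comm _ _) (add_comm _ _)⟩

/-! ### Perturbation of eigenbases -/

theorem exists_pos_le_abs_sub {ι : Type*} [Fintype ι] (w : ι → ℝ) :
    ∃ c > 0, ∀ i j, w i ≠ w j → c ≤ |w i - w j| := by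
  classical
  let s : Finset (ι × ι) := Finset.univ.filter fun p => w p.1 ≠ w p.2
  rcases s.eq_empty_or_nonempty with hs | hs
  -- No two values differ, so any positive constant serves.
  · refine ⟨1, one_pos, fun i j hij => ?_⟩
    have : (i, j) ∈ s := by simp [s, hij]
    simp [hs] at this
  · obtain ⟨p, hp, hmin⟩ := s.exists_min_image (fun p => |w p.1 - w p.2|) hs
    refine ⟨|w p.1 - w p.2|, abs_pos.2 (sub_ne_zero.2 (by simpa [s] using hp)), fun i j hij => ?_⟩
    exact hmin (i, j) (by simp [s, hij])

theorem conj_diagonal_mul {P : Matrix (Fin n) (Fin n) ℝ} (hP : P ∈ orthogonalGroup (Fin n) ℝ)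
    (x y : Fin n → ℝ) :
    P * diagonal x * Pᵀ * (P * diagonal y * Pᵀ) = P * diagonal (fun i => x i * y i) * Pᵀ := by
  calc _ = P * diagonal x * (Pᵀ * P) * diagonal y * Pᵀ := by simp only [Matrix.mul_assoc]
    _ = _ := by
      rw [transpose_mul_self_of_orthogonal hP, Matrix.mul_one, Matrix.mul_assoc P,
        diagonal_mul_diagonal]

/-- In the basis `P`, commuting with `Diag(s)` means having zero entries wherever `s i ≠ s j`, and
this implies commuting with `Diag(f ∘ s)`. -/
theorem commute_conj_diagonal_comp {P M : Matrix (Fin n) (Fin n) ℝ}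
    (hP : P ∈ orthogonalGroup (Fin n) ℝ) {s : Fin n → ℝ} (f : ℝ → ℝ)
    (h : Commute (P * diagonal s * Pᵀ) M) :
    Commute (P * diagonal (fun i => f (s i)) * Pᵀ) M := by
  have hP1 := transpose_mul_self_of_orthogonal hP
  have hP2 := mul_transpose_self_of_orthogonal hP
  have hN : diagonal s * (Pᵀ * M * P) = Pᵀ * M * P * diagonal s := by
    calc _ = (Pᵀ * P) * diagonal s * (Pᵀ * M * P) := by rw [hP1, Matrix.one_mul]
      _ = Pᵀ * ((P * diagonal s * Pᵀ) * M) * P := by simp only [Matrix.mul_assoc]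
      _ = Pᵀ * (M * (P * diagonal s * Pᵀ)) * P := by rw [h.eq]
      _ = Pᵀ * M * P * diagonal s * (Pᵀ * P) := by simp only [Matrix.mul_assoc]
      _ = _ := by rw [hP1, Matrix.mul_one]
  have hN' : diagonal (fun i => f (s i)) * (Pᵀ * M * P) =
      Pᵀ * M * P * diagonal (fun i => f (s i)) := by
    ext i j
    have hij := congrFun₂ hN i j
    rw [diagonal_mul, mul_diagonal] at hij ⊢
    rcases eq_or_ne (s i) (s j) with hs | hs
    · rw [hs, mul_comm]
    · have : (Pᵀ * M * P) i j = 0 := by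
        have : (s i - s j) * (Pᵀ * M * P) i j = 0 := by linarith
        exact (mul_eq_zero.1 this).resolve_left (sub_ne_zero.2 hs)
      rw [this, mul_zero, zero_mul]
  calc _ = P * diagonal (fun i => f (s i)) * Pᵀ * M * (P * Pᵀ) := by rw [hP2, Matrix.mul_one]
    _ = P * (diagonal (fun i => f (s i)) * (Pᵀ * M * P)) * Pᵀ := by simp only [Matrix.mul_assoc]
    _ = P * (Pᵀ * M * P * diagonal (fun i => f (s i))) * Pᵀ := by rw [hN']
    _ = (P * Pᵀ) * M * (P * diagonal (fun i => f (s i)) * Pᵀ) := by simp only [Matrix.mul_assoc]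
    _ = _ := by rw [hP2, Matrix.one_mul]

/-- The orthogonal polar factor of a nearly orthogonal matrix `B` is close to `B` and commutes
with every symmetric matrix that commutes with `B`. -/
theorem exists_orthogonal_near {B : Matrix (Fin n) (Fin n) ℝ} (hB : ‖Bᵀ * B - 1‖ < 1) :
    ∃ V ∈ orthogonalGroup (Fin n) ℝ, ‖B - V‖ ≤ ‖Bᵀ * B - 1‖ ∧
      ∀ D : Matrix (Fin n) (Fin n) ℝ, Dᵀ = D → Commute B D → Commute V D := by
  have hsymm : (Bᵀ * B)ᵀ = Bᵀ * B := by simp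
  obtain ⟨P, hP, hS⟩ := exists_eq_conjDiagonal ⟨Bᵀ * B, hsymm⟩
  generalize eigenvalueVector _ = s at hS
  replace hS : Bᵀ * B = P * diagonal s * Pᵀ := congrArg Subtype.val hS
  have hP2 := mul_transpose_self_of_orthogonal hP
  have hP' := transpose_mem_orthogonalGroup hP
  have hone : P * diagonal (fun _ => 1) * Pᵀ = 1 := by
    rw [diagonal_one, Matrix.mul_one, hP2]
  have hnorm : ∀ x : Fin n → ℝ, ‖P * diagonal x * Pᵀ - 1‖ = ‖diagonal fun i => x i - 1‖ :=
    fun x => by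
      rw [← hone, ← Matrix.sub_mul, ← Matrix.mul_sub, diagonal_sub,
        frobenius_norm_mul_orthogonal hP', frobenius_norm_orthogonal_mul hP]
  have hs : ∀ i, 0 < s i := fun i => by
    rw [hS, hnorm, frobenius_norm_diagonal] at hB
    have := (PiLp.norm_apply_le (WithLp.toLp 2 fun i => s i - 1) i).trans_lt hB
    rw [PiLp.toLp_apply, Real.norm_eq_abs, abs_lt] at this
    linarith
  -- This is `B (Bᵀ B)^(-1/2)`.
  let V := B * (P * diagonal (fun i => (√(s i))⁻¹) * Pᵀ)
  have hV : V ∈ orthogonalGroup (Fin n) ℝ := by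
    rw [mem_orthogonalGroup_iff']
    calc Vᵀ * V = P * diagonal (fun i => (√(s i))⁻¹) * Pᵀ * (Bᵀ * B) *
          (P * diagonal (fun i => (√(s i))⁻¹) * Pᵀ) := by
          simp [V, Matrix.mul_assoc]
      _ = P * diagonal (fun _ => 1) * Pᵀ := by
          rw [hS, conj_diagonal_mul hP, conj_diagonal_mul hP]
          congr 3
          funext i
          have := Real.sqrt_pos.2 (hs i)
          nth_rewrite 2 [← Real.mul_self_sqrt (hs i).le]
          field_simp
      _ = 1 := hone
  refine ⟨V, hV, ?_, fun D hD hBD => ?_⟩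
  -- Since `B - V = V ((Bᵀ B)^(1/2) - 1)`, the bound reduces to `|√s - 1| ≤ |s - 1|` on eigenvalues.
  · have hBV : B = V * (P * diagonal (fun i => √(s i)) * Pᵀ) := by
      have : (fun i => (√(s i))⁻¹ * √(s i)) = fun _ => (1 : ℝ) :=
        funext fun i => inv_mul_cancel₀ (Real.sqrt_pos.2 (hs i)).ne'
      rw [Matrix.mul_assoc, conj_diagonal_mul hP, this, hone, Matrix.mul_one]
    have hsub : B - V = V * (P * diagonal (fun i => √(s i)) * Pᵀ - 1) := by
      rw [Matrix.mul_sub, Matrix.mul_one, ← hBV]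
    rw [hsub, frobenius_norm_orthogonal_mul hV, hS, hnorm, hnorm, ← one_mul ‖diagonal _‖]
    refine frobenius_norm_le_mul_of_abs_le zero_le_one fun i j => ?_
    rw [one_mul, diagonal_apply, diagonal_apply]
    split_ifs
    · have h1 : s i - 1 = (√(s i) - 1) * (√(s i) + 1) := by
        linear_combination -(Real.mul_self_sqrt (hs i).le)
      rw [h1, abs_mul]
      refine le_mul_of_one_le_right (abs_nonneg _) ?_
      rw [abs_of_nonneg (by positivity)]
      linarith [Real.sqrt_nonneg (s i)]
    · rfl
  · have hBt : Commute Bᵀ D := by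
      have := congrArg transpose hBD.eq
      rw [transpose_mul, transpose_mul, hD] at this
      exact this.symm
    have hS' : Commute (P * diagonal s * Pᵀ) D := hS ▸ hBt.mul_left hBD
    exact hBD.mul_left (commute_conj_diagonal_comp hP (fun t => (√t)⁻¹) hS')

/-- Near `conjDiagonal Q w`, every ordered eigenbasis is Lipschitz close to an eigenbasis of
`conjDiagonal Q w`. -/
theorem exists_eigenbasis_near {Q : Matrix (Fin n) (Fin n) ℝ}
    (hQ : Q ∈ orthogonalGroup (Fin n) ℝ) (w : EuclideanSpace ℝ (Fin n)) :
    ∃ δ > 0, ∃ C > 0, ∀ U ∈ orthogonalGroup (Fin n) ℝ, ∀ v : EuclideanSpace ℝ (Fin n),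
      ‖v - w‖ ≤ ‖conjDiagonal U v - conjDiagonal Q w‖ →
      ‖conjDiagonal U v - conjDiagonal Q w‖ ≤ δ →
      ∃ V ∈ orthogonalGroup (Fin n) ℝ, conjDiagonal V w = conjDiagonal Q w ∧
        ‖U - V‖ ≤ C * ‖conjDiagonal U v - conjDiagonal Q w‖ := by
  obtain ⟨c, hc, hgap⟩ := exists_pos_le_abs_sub w
  -- With `c` the least gap in `w`, the part `E` of `Qᵀ U` linking distinct eigenvalues satisfies
  -- `‖E‖ ≤ 2η / c ≤ 1 / 4`, and the final error is at most `4 ‖E‖ ≤ 8η / c`.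
  refine ⟨c / 8, by positivity, 8 / c, by positivity, fun U hU v hvw hδ => ?_⟩
  set η := ‖conjDiagonal U v - conjDiagonal Q w‖ with hη
  have hQ1 := transpose_mul_self_of_orthogonal hQ
  have hQ2 := mul_transpose_self_of_orthogonal hQ
  have hQ' := transpose_mem_orthogonalGroup hQ
  let R := Qᵀ * U
  have hR : R ∈ orthogonalGroup (Fin n) ℝ := mul_mem hQ' hU
  have hR1 := transpose_mul_self_of_orthogonal hR
  have hcomm : ‖R * diagonal v - diagonal w * R‖ = η := by
    have : R * diagonal v - diagonal w * R =
        Qᵀ * (U * diagonal v * Uᵀ - Q * diagonal w * Qᵀ) * U := by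
      calc _ = Qᵀ * U * diagonal v * (Uᵀ * U) - (Qᵀ * Q) * diagonal w * Qᵀ * U := by
            rw [transpose_mul_self_of_orthogonal hU, hQ1, Matrix.mul_one, Matrix.one_mul]
            simp only [R, Matrix.mul_assoc]
        _ = _ := by simp only [Matrix.mul_sub, Matrix.sub_mul, Matrix.mul_assoc]
    rw [this, frobenius_norm_mul_orthogonal hU, frobenius_norm_orthogonal_mul hQ']
    rfl
  -- The assumed bound on `v - w` allows `v` to be replaced by `w`; the entries of this commutator
  -- are `(w j - w i) * R i j`.
  have hcomm' : ‖R * diagonal w - diagonal w * R‖ ≤ 2 * η := by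
    have h1 : R * diagonal w - diagonal w * R =
        (R * diagonal v - diagonal w * R) - R * diagonal (v - w) := by
      have : diagonal (v - w) = diagonal v - diagonal w := by rw [diagonal_sub]; rfl
      rw [this, Matrix.mul_sub]
      abel
    have h2 : ‖R * diagonal (v - w)‖ = ‖v - w‖ := by
      rw [frobenius_norm_orthogonal_mul hR]
      exact frobenius_norm_diagonal _
    rw [h1]
    linarith [norm_sub_le (R * diagonal v - diagonal w * R) (R * diagonal (v - w))]
  let E : Matrix (Fin n) (Fin n) ℝ := Matrix.of fun i j => if w i = w j then 0 else R i j
  have hE : c * ‖E‖ ≤ 2 * η := by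
    refine (frobenius_norm_le_mul_of_abs_le hc.le fun i j => ?_).trans hcomm'
    rw [Matrix.sub_apply, mul_diagonal, diagonal_mul]
    by_cases h : w i = w j
    · simp [E, h]
    · have : R i j * w j - w i * R i j = (w j - w i) * R i j := by ring
      rw [this, abs_mul]
      simp only [E, of_apply, h, if_false]
      exact mul_le_mul_of_nonneg_right (hgap j i (Ne.symm h)) (abs_nonneg _)
  have hE' : ‖E‖ ≤ 1 / 4 := by
    have : c * ‖E‖ ≤ c * (1 / 4) := by linarith
    exact le_of_mul_le_mul_left this hc
  have hBD : Commute (R - E) (diagonal w) := by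
    ext i j
    rw [mul_diagonal, diagonal_mul, Matrix.sub_apply]
    by_cases h : w i = w j
    · rw [h, mul_comm]
    · simp [E, h]
  have hBB : (R - E)ᵀ * (R - E) - 1 = Eᵀ * E - Eᵀ * R - Rᵀ * E := by
    rw [← hR1, transpose_sub, Matrix.sub_mul, Matrix.mul_sub, Matrix.mul_sub]
    abel
  have hBB' : ‖(R - E)ᵀ * (R - E) - 1‖ ≤ 3 * ‖E‖ - ‖E‖ / 2 := by
    have h1 : ‖Eᵀ * E‖ ≤ ‖E‖ * ‖E‖ := by
      simpa [frobenius_norm_transpose] using frobenius_norm_mul Eᵀ E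
    have h2 : ‖Eᵀ * R‖ = ‖E‖ := by
      rw [frobenius_norm_mul_orthogonal hR, frobenius_norm_transpose]
    have h3 : ‖Rᵀ * E‖ = ‖E‖ := frobenius_norm_orthogonal_mul (transpose_mem_orthogonalGroup hR) E
    have h4 : ‖E‖ * ‖E‖ ≤ 1 / 4 * ‖E‖ := mul_le_mul_of_nonneg_right hE' (norm_nonneg _)
    rw [hBB]
    linarith [norm_sub_le (Eᵀ * E - Eᵀ * R) (Rᵀ * E), norm_sub_le (Eᵀ * E) (Eᵀ * R),
      norm_nonneg E]
  -- `R - E` is nearly orthogonal and commutes with `Diag(w)`; its polar factor keeps the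
  -- commutation, so `Q V` is again an eigenbasis of `Q Diag(w) Qᵀ`.
  obtain ⟨V, hV, hVB, hVD⟩ := exists_orthogonal_near (B := R - E) (by linarith)
  have hVw := (hVD _ (diagonal_transpose _) hBD).eq
  refine ⟨Q * V, mul_mem hQ hV, Subtype.ext ?_, ?_⟩
  · calc Q * V * diagonal w * (Q * V)ᵀ = Q * (V * diagonal w) * Vᵀ * Qᵀ := by
          simp only [transpose_mul, Matrix.mul_assoc]
      _ = Q * diagonal w * (V * Vᵀ) * Qᵀ := by rw [hVw]; simp only [Matrix.mul_assoc]
      _ = Q * diagonal w * Qᵀ := by rw [mul_transpose_self_of_orthogonal hV, Matrix.mul_one]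
  · have h1 : U - Q * V = Q * (E + (R - E - V)) := by
      have : Q * R = U := by rw [← Matrix.mul_assoc, hQ2, Matrix.one_mul]
      rw [sub_sub, add_sub_left_comm, sub_add_cancel_left, ← sub_eq_add_neg, Matrix.mul_sub, this]
    rw [h1, frobenius_norm_orthogonal_mul hQ, div_mul_eq_mul_div, le_div_iff₀ hc]
    have h2 := norm_add_le E (R - E - V)
    have h3 : ‖E + (R - E - V)‖ ≤ 4 * ‖E‖ := by linarith [norm_nonneg E]
    nlinarith

theorem norm_conjDiagonal_sub_conjDiagonal_le {U V : Matrix (Fin n) (Fin n) ℝ}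
    (hU : U ∈ orthogonalGroup (Fin n) ℝ) (hV : V ∈ orthogonalGroup (Fin n) ℝ)
    (x : EuclideanSpace ℝ (Fin n)) :
    ‖conjDiagonal U x - conjDiagonal V x‖ ≤ 2 * ‖U - V‖ * ‖x‖ := by
  have hx : ‖diagonal x‖ = ‖x‖ := frobenius_norm_diagonal _
  have h : U * diagonal x * Uᵀ - V * diagonal x * Vᵀ =
      (U - V) * diagonal x * Uᵀ + V * (diagonal x * (U - V)ᵀ) := by
    simp only [transpose_sub, Matrix.sub_mul, Matrix.mul_sub, Matrix.mul_assoc]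
    abel
  change ‖U * diagonal x * Uᵀ - V * diagonal x * Vᵀ‖ ≤ _
  rw [h]
  refine (norm_add_le _ _).trans ?_
  rw [frobenius_norm_mul_orthogonal (transpose_mem_orthogonalGroup hU),
    frobenius_norm_orthogonal_mul hV]
  have h1 := frobenius_norm_mul (U - V) (diagonal x)
  have h2 := frobenius_norm_mul (diagonal x) (U - V)ᵀ
  rw [frobenius_norm_transpose, hx] at h2
  rw [hx] at h1
  linarith

/-! ### Subgradients of spectral functions -/

/-- If `λ(W) ∈ ∂g(y)` and `V` is an ordered eigenbasis of `W`, then `W ∈ ∂θ(V Diag(y) Vᵀ)`. -/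
theorem mem_subdifferential_conjDiagonal {g : EuclideanSpace ℝ (Fin n) → EReal}
    (hsymm : IsSymmetricFun g) {W : SymMat n} {V : Matrix (Fin n) (Fin n) ℝ}
    (hV : V ∈ orthogonalGroup (Fin n) ℝ) (hW : conjDiagonal V (eigenvalueVector W) = W)
    {y : EuclideanSpace ℝ (Fin n)} (hy : eigenvalueVector W ∈ subdifferential g y) :
    W ∈ subdifferential (spectralFunction g) (conjDiagonal V y) := by
  intro Z
  rw [spectralFunction_conjDiagonal hsymm hV]
  refine le_trans ?_ (hy (eigenvalueVector Z))
  gcongr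
  have h1 : ⟪W, conjDiagonal V y⟫ = ⟪eigenvalueVector W, y⟫ := by
    conv_lhs => rw [← hW, inner_conjDiagonal hV]
  rw [inner_sub_right, inner_sub_right, h1]
  linarith [inner_le_inner_eigenvalueVector W Z]

/-- The subgradient inequality is tested on `U Diag(z) Uᵀ` with `U` an eigenbasis of `W`. Taking `z
= λ(X)` gives equality in Fan's inequality; general `z` gives the subgradient of `g`. -/
theorem eigenvalueVector_mem_subdifferential {g : EuclideanSpace ℝ (Fin n) → EReal}
    (hg : IsProperClosedConvex g) (hsymm : IsSymmetricFun g) {X W : SymMat n}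
    (hW : W ∈ subdifferential (spectralFunction g) X) :
    eigenvalueVector W ∈ subdifferential g (eigenvalueVector X) ∧
      ⟪eigenvalueVector X, eigenvalueVector W⟫ ≤ ⟪X, W⟫ := by
  obtain ⟨U, hU, hWU⟩ := exists_eq_conjDiagonal W
  have hz : ∀ z, g (eigenvalueVector X) +
      ((⟪eigenvalueVector W, z⟫ - ⟪X, W⟫ : ℝ) : EReal) ≤ g z := fun z => by
    have := hW (conjDiagonal U z)
    have h1 : ⟪W, conjDiagonal U z⟫ = ⟪eigenvalueVector W, z⟫ := by
      conv_lhs => rw [hWU, inner_conjDiagonal hU]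
    rwa [spectralFunction_conjDiagonal hsymm hU, inner_sub_right, h1, real_inner_comm X W] at this
  have hle : ⟪eigenvalueVector X, eigenvalueVector W⟫ ≤ ⟪X, W⟫ := by
    -- Cancelling `g(λ(X))` requires it to be finite; the value `⊤` would make `g` identically `⊤`.
    have hbot := hg.ne_bot (eigenvalueVector X)
    have htop : g (eigenvalueVector X) ≠ ⊤ := fun h => by
      obtain ⟨z, hz'⟩ := hg.exists_ne_top
      have := hz z
      rw [h, EReal.top_add_coe, top_le_iff] at this
      exact hz' this
    have := hz (eigenvalueVector X)
    lift g (eigenvalueVector X) to ℝ using ⟨htop, hbot⟩ with a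
    rw [← EReal.coe_add, EReal.coe_le_coe_iff, real_inner_comm] at this
    linarith
  refine ⟨fun z => le_trans ?_ (hz z), hle⟩
  gcongr
  rw [inner_sub_right, real_inner_comm (eigenvalueVector X) (eigenvalueVector W)]
  linarith [inner_le_inner_eigenvalueVector X W]

end SpectralSubregularity

theorem proposition15 (n : ℕ) (g : EuclideanSpace ℝ (Fin n) → EReal)
    (hg : IsProperClosedConvex g) (hsymm : IsSymmetricFun g) (X₀ W₀ : SymMat n)
    (hW₀ : W₀ ∈ subdifferential (spectralFunction g) X₀)
    (hsub : MetricallySubregularAt (subdifferential g)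
      (eigenvalueVector X₀) (eigenvalueVector W₀)) :
    MetricallySubregularAt (subdifferential (spectralFunction g)) X₀ W₀ := by
  obtain ⟨-, δ, hδ, ε, hε, κ, hκ, hdist⟩ := hsub
  obtain ⟨Q, hQ, hWQ⟩ := exists_eq_conjDiagonal W₀
  obtain ⟨δ', hδ', C, hC, hnear⟩ := exists_eigenbasis_near hQ (eigenvalueVector W₀)
  rw [← hWQ] at hnear
  -- The first summand pays for rotating `X` from `U` to `V`, the second for the distance measured
  -- by `g`.
  set K := 2 * C * (‖X₀‖ + ε) + κ with hK
  have hKpos : 0 < K := by positivity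
  refine ⟨hW₀, min δ δ', lt_min hδ hδ', ε, hε, K, hKpos, fun X hX => ?_⟩
  have hX' : ‖X - X₀‖ ≤ ε := by rwa [← dist_eq_norm, ← Metric.mem_closedBall]
  -- Dividing by `K` isolates the infimum, so one `W` at a time can be treated; an empty set needs
  -- no separate case.
  rw [← ENNReal.div_le_iff' (by simpa using hKpos) ENNReal.ofReal_ne_top]
  refine Metric.le_infEDist.2 fun W hW => ?_
  rw [ENNReal.div_le_iff' (by simpa using hKpos) ENNReal.ofReal_ne_top]
  obtain ⟨hWX, hWδ⟩ := hW
  rw [Metric.mem_closedBall, dist_eq_norm, le_min_iff] at hWδ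
  obtain ⟨hsubg, hfan⟩ := eigenvalueVector_mem_subdifferential hg hsymm hWX
  obtain ⟨U, hU, hXU, hWU⟩ := exists_simultaneous_conjDiagonal hfan
  have hlam := norm_eigenvalueVector_sub_le W W₀
  obtain ⟨V, hV, hVW, hUV⟩ := hnear U hU (eigenvalueVector W)
    (by rwa [← hWU]) (by rw [← hWU]; exact hWδ.2)
  rw [← hWU] at hUV
  set x := eigenvalueVector X with hx
  have hstep1 : edist X (conjDiagonal V x) ≤ ENNReal.ofReal (2 * C * (‖X₀‖ + ε) * ‖W - W₀‖) := by
    rw [edist_dist, dist_eq_norm]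
    refine ENNReal.ofReal_le_ofReal ?_
    have h1 := norm_conjDiagonal_sub_conjDiagonal_le hU hV x
    rw [← hXU, norm_eigenvalueVector] at h1
    have h2 : ‖X‖ ≤ ‖X₀‖ + ε := by linarith [norm_le_norm_add_norm_sub' X X₀]
    calc _ ≤ 2 * ‖U - V‖ * ‖X‖ := h1
      _ ≤ 2 * (C * ‖W - W₀‖) * (‖X₀‖ + ε) := by gcongr
      _ = _ := by ring
  have hstep2 : Metric.infEDist (conjDiagonal V x)
      {X' | W₀ ∈ subdifferential (spectralFunction g) X'} ≤
      Metric.infEDist x {y | eigenvalueVector W₀ ∈ subdifferential g y} := by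
    refine Metric.le_infEDist.2 fun y hy => ?_
    have hmem := mem_subdifferential_conjDiagonal hsymm hV hVW hy
    have hxy : edist (conjDiagonal V x) (conjDiagonal V y) = edist x y := by
      rw [edist_dist, dist_conjDiagonal hV, edist_dist]
    rw [← hxy]
    exact Metric.infEDist_le_edist_of_mem
      (s := {X' | W₀ ∈ subdifferential (spectralFunction g) X'}) hmem
  have hstep3 : Metric.infEDist x {y | eigenvalueVector W₀ ∈ subdifferential g y} ≤
      ENNReal.ofReal (κ * ‖W - W₀‖) := by
    refine (hdist x ?_).trans ?_
    · rw [Metric.mem_closedBall, dist_eq_norm]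
      exact (norm_eigenvalueVector_sub_le X X₀).trans hX'
    · rw [ENNReal.ofReal_mul hκ.le]
      gcongr
      have hball : eigenvalueVector W ∈ Metric.closedBall (eigenvalueVector W₀) δ := by
        rw [Metric.mem_closedBall, dist_eq_norm]
        exact hlam.trans hWδ.1
      refine (Metric.infEDist_le_edist_of_mem (Set.mem_inter hsubg hball)).trans ?_
      rw [edist_comm, edist_dist, dist_eq_norm]
      exact ENNReal.ofReal_le_ofReal hlam
  calc Metric.infEDist X {X' | W₀ ∈ subdifferential (spectralFunction g) X'}
      ≤ edist X (conjDiagonal V x) + Metric.infEDist (conjDiagonal V x)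
          {X' | W₀ ∈ subdifferential (spectralFunction g) X'} :=
        Metric.infEDist_le_edist_add_infEDist
    _ ≤ ENNReal.ofReal (2 * C * (‖X₀‖ + ε) * ‖W - W₀‖) + ENNReal.ofReal (κ * ‖W - W₀‖) :=
        add_le_add hstep1 (hstep2.trans hstep3)
    _ = ENNReal.ofReal K * edist W₀ W := by
        rw [← ENNReal.ofReal_add (by positivity) (by positivity), ← add_mul, ← hK,
          ENNReal.ofReal_mul hKpos.le, edist_comm, edist_dist, dist_eq_norm]
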